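/- Let $n\in\mathbb N$ and let $g:[0,\infty)\to(0,\infty)$ be twice differentiable (one-sidedly at $0$) with $g'(t)\le 0$ and $g''(t)\ge 0$ for all $t\ge 0$, $g\notin L^1(0,\infty)$, and, for $k=1,2$, $|g^{(k)}(t)|\le C_k\,g(t)(1+t)^{-k}$ for all $t\ge 0$ with constants $C_k>0$. Consider the Cauchy problem $$u_{tt}-\Delta u+g(t)(-\Delta)u_t=0\ \text{ in }(0,\infty)\times\mathbb R^n,\qquad u(0,\cdot)=u_0,\quad u_t(0,\cdot)=u_1 .$$ A Sobolev solution is a function $u\in C^1([0,\infty),L^2(\mathbb R^n))$ with $u(0)=u_0$, $u_t(0)=u_1$ that satisfies the equation in the sense of tempered distributions: for every Schwartz function $\varphi$ and every $t>0$, the function $\tau\mapsto\langle u_t(\tau),\varphi\rangle$ is differentiable at $t$ with derivative $\langle \Delta u(t)+g(t)\Delta u_t(t),\varphi\rangle$. Put $G(t)=1+\int_0^t g(\tau)\,d\tau$. (i) For every real $s\ge 1$ there is a constant $C>0$, depending only on $n,g,s$, such that for all $(u_0,u_1)\in H^{s}\times H^{s-1}$, every Sobolev solution $u$ and all $t\ge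 0$, one has $|D|^{s}u(t,\cdot)\in L^2$ and $$\||D|^{s}u(t,\cdot)\|_{L^2}\le C\Big(G(t)^{-\frac{s}{2}}\|u_0\|_{H^{s}}+G(t)^{-\frac{s-1}{2}}\|u_1\|_{H^{s-1}}\Big).$$ (ii) For every real $s\ge 0$ there is a constant $C>0$, depending only on $n,g,s$, such that for all $(u_0,u_1)\in H^{s+1}\times H^{s}$, every Sobolev solution $u$ and all $t\ge 0$, one has $|D|^{s}u_t(t,\cdot)\in L^2$ and $$\||D|^{s}u_t(t,\cdot)\|_{L^2}\le C\Big(G(t)^{-\frac{s+1}{2}}\|u_0\|_{H^{s+1}}+G(t)^{-\frac{s}{2}}\|u_1\|_{H^{s}}\Big).$$ (iii) (Parabolic effect) The rates improve with the order: for all real $r<s$, $G(t)^{-s/2}=o\big(G(t)^{-r/2}\big)$ as $t\to\infty$. -/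

import Mathlib

open MeasureTheory Set Filter Topology
open scoped FourierTransform SchwartzMap Laplacian

noncomputable section

/-- The space `L²(ℝⁿ; ℂ)`. -/
abbrev L2 (n : ℕ) : Type :=
  Lp (α := EuclideanSpace ℝ (Fin n)) ℂ 2 volume

/-- `f ∈ L²` lies in the domain of the pseudo-differential operator `m(D)`, that is,
`m · f̂ ∈ L²`. Here `f̂ = 𝓕 f` is the `L²` Fourier transform with kernel `e^{-2πi x·ξ}`. -/
def InMultiplierDomain {n : ℕ} (m : EuclideanSpace ℝ (Fin n) → ℝ) (f : L2 n) : Prop :=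
  MemLp (fun ξ => (m ξ : ℂ) * (𝓕 f : L2 n) ξ) 2 volume

/-- The pseudo-differential operator `m(D) f = 𝓕⁻¹ (m · 𝓕 f)` on its `L²` domain. -/
def multiplierOp {n : ℕ} (m : EuclideanSpace ℝ (Fin n) → ℝ) (f : L2 n)
    (hf : InMultiplierDomain m f) : L2 n :=
  𝓕⁻ (MemLp.toLp _ hf : L2 n)

/-- Symbol of `|D|^s = (-Δ)^{s/2}`. With the kernel `e^{-2πi x·ξ}`, the frequency variable of the
unnormalised kernel `e^{-i x·ξ}` is `2πξ`, so that `-Δ` has symbol `(2π‖ξ‖)²`. -/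
def rieszSymbol (n : ℕ) (s : ℝ) (ξ : EuclideanSpace ℝ (Fin n)) : ℝ :=
  (2 * Real.pi * ‖ξ‖) ^ s

/-- Symbol of `⟨D⟩^s = (1 - Δ)^{s/2}`. -/
def besselSymbol (n : ℕ) (s : ℝ) (ξ : EuclideanSpace ℝ (Fin n)) : ℝ :=
  (1 + (2 * Real.pi * ‖ξ‖) ^ 2) ^ (s / 2)

/-- Membership of an `L²` function in the Bessel potential space `H^s(ℝⁿ)`. -/
def InSobolevSpace {n : ℕ} (s : ℝ) (f : L2 n) : Prop :=
  InMultiplierDomain (besselSymbol n s) f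

/-- The norm `‖f‖_{H^s} = ‖⟨D⟩^s f‖_{L²}`. -/
def sobolevNorm {n : ℕ} (s : ℝ) (f : L2 n) (hf : InSobolevSpace s f) : ℝ :=
  ‖multiplierOp (besselSymbol n s) f hf‖

/-- `|D|^s f ∈ L²`. -/
def InRieszDomain {n : ℕ} (s : ℝ) (f : L2 n) : Prop :=
  InMultiplierDomain (rieszSymbol n s) f

/-- The function `|D|^s f ∈ L²`. -/
def rieszD {n : ℕ} (s : ℝ) (f : L2 n) (hf : InRieszDomain s f) : L2 n :=
  multiplierOp (rieszSymbol n s) f hf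

/-- The assumptions on the coefficient `g` on `[0, ∞)`: it is twice differentiable, positive,
non-increasing and convex, not integrable, and `|g^{(k)}(t)| ≤ C_k g(t) (1 + t)^{-k}` for
`k = 1, 2`. Derivatives at `0` are one-sided. -/
structure IsDecreasingCoefficient (g : ℝ → ℝ) : Prop where
  differentiableOn : DifferentiableOn ℝ g (Ici 0)
  differentiableOn_deriv : DifferentiableOn ℝ (derivWithin g (Ici 0)) (Ici 0)
  pos : ∀ t, 0 ≤ t → 0 < g t
  deriv_nonpos : ∀ t, 0 ≤ t → iteratedDerivWithin 1 g (Ici 0) t ≤ 0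
  deriv_two_nonneg : ∀ t, 0 ≤ t → 0 ≤ iteratedDerivWithin 2 g (Ici 0) t
  not_integrable : ¬ IntegrableOn g (Ioi 0)
  deriv_bound : ∀ k : ℕ, k = 1 ∨ k = 2 → ∃ C : ℝ, 0 < C ∧ ∀ t, 0 ≤ t →
    |iteratedDerivWithin k g (Ici 0) t| ≤ C * g t * (1 / (1 + t)) ^ k

/-- `u ∈ C¹([0, ∞); L²(ℝⁿ))`, with time derivative `ut`, is a (distributional) Sobolev solution of
`u_tt - Δu + g(t) (-Δ) u_t = 0`, `u(0) = u₀`, `u_t(0) = u₁`: in the space of tempered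
distributions, `∂_t (u_t)(t) = Δ u(t) + g(t) Δ u_t(t)` for every `t > 0`. -/
structure IsSobolevSolution {n : ℕ} (g : ℝ → ℝ) (u₀ u₁ : L2 n) (u ut : ℝ → L2 n) : Prop where
  hasDeriv : ∀ t, 0 ≤ t → HasDerivWithinAt u (ut t) (Ici 0) t
  continuousOn_deriv : ContinuousOn ut (Ici 0)
  initial : u 0 = u₀
  initial_deriv : ut 0 = u₁
  equation : ∀ t, 0 < t → ∀ φ : 𝓢(EuclideanSpace ℝ (Fin n), ℂ),
    HasDerivAt (fun τ => (ut τ : 𝓢'(EuclideanSpace ℝ (Fin n), ℂ)) φ)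
      (Δ (u t : 𝓢'(EuclideanSpace ℝ (Fin n), ℂ)) φ
        + (g t : ℂ) * Δ (ut t : 𝓢'(EuclideanSpace ℝ (Fin n), ℂ)) φ) t

/-- `1 + ∫₀ᵗ g(τ) dτ`. -/
def decayWeight (g : ℝ → ℝ) (t : ℝ) : ℝ :=
  1 + ∫ τ in (0 : ℝ)..t, g τ

end

open MeasureTheory Set Filter Topology
open scoped FourierTransform SchwartzMap Laplacian

noncomputable section

/-! ### Monotonicity of the coefficient and growth of its primitive -/

namespace IsDecreasingCoefficient

variable {g : ℝ → ℝ}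

/-! At frequency `ρ = 2π‖ξ‖` the equation reads `v'' + ρ² v + g ρ² v' = 0`. The energy `|v'|² +
ρ²|v|²` is dissipated only through `2gρ²|v'|²`; adding a small multiple of `g v v'` makes the
potential part decay too. Two further corrections, in `g² ρ²|v|²` and `-g'|v|²`, cancel the terms of
indefinite sign, and what remains is favourable because `g' ≤ 0 ≤ g''` (`energy_decay`). The energy
is thus bounded by its initial value times `4 exp(-c q ∫g)`, where `q = ρ²/(1+ρ²)` behaves like `ρ²`
at low frequencies and saturates at high ones.

A distributional solution does not directly give an ODE at fixed `ξ`. The energy argument therefore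
runs in `L²` over bounded sets of frequencies, where multiplication by `ρ²` is a bounded operator;
varying the set yields the bound at almost every `ξ` (`exists_ae_energy_le`).

Finally `ρ^a = q^(a/2) (1+ρ²)^(a/2)`: the first factor against the exponential gives the decay
`G^(-a/2)`, the second is paid for by the Sobolev norm of the data (`exists_rpow_mul_exp_le`). One
pointwise bound, applied to `ρ|û|` and to `|û_t|`, gives both estimates. -/

lemma hasDerivAt (hg : IsDecreasingCoefficient g) {t : ℝ} (ht : 0 < t) :
    HasDerivAt g (derivWithin g (Ici 0) t) t :=
  (hg.differentiableOn t ht.le).hasDerivWithinAt.hasDerivAt (Ici_mem_nhds ht)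

lemma hasDerivAt_deriv (hg : IsDecreasingCoefficient g) {t : ℝ} (ht : 0 < t) :
    HasDerivAt (derivWithin g (Ici 0)) (derivWithin (derivWithin g (Ici 0)) (Ici 0) t) t :=
  (hg.differentiableOn_deriv t ht.le).hasDerivWithinAt.hasDerivAt (Ici_mem_nhds ht)

lemma derivWithin_nonpos (hg : IsDecreasingCoefficient g) {t : ℝ} (ht : 0 ≤ t) :
    derivWithin g (Ici 0) t ≤ 0 := by
  simpa [iteratedDerivWithin_one] using hg.deriv_nonpos t ht

lemma derivWithin_two_nonneg (hg : IsDecreasingCoefficient g) {t : ℝ} (ht : 0 ≤ t) :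
    0 ≤ derivWithin (derivWithin g (Ici 0)) (Ici 0) t := by
  have h := hg.deriv_two_nonneg t ht
  rw [iteratedDerivWithin_succ] at h
  rwa [derivWithin_congr (fun x _ => by rw [iteratedDerivWithin_one])
    (by rw [iteratedDerivWithin_one])] at h

lemma continuousOn (hg : IsDecreasingCoefficient g) : ContinuousOn g (Ici 0) :=
  hg.differentiableOn.continuousOn

lemma antitoneOn (hg : IsDecreasingCoefficient g) : AntitoneOn g (Ici 0) := by
  refine antitoneOn_of_deriv_nonpos (convex_Ici 0) hg.continuousOn ?_ ?_
  · rw [interior_Ici]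
    exact fun t ht => (hg.hasDerivAt ht).differentiableAt.differentiableWithinAt
  · rw [interior_Ici]
    intro t ht
    rw [(hg.hasDerivAt ht).deriv]
    exact hg.derivWithin_nonpos (le_of_lt ht)

lemma le_zero (hg : IsDecreasingCoefficient g) {t : ℝ} (ht : 0 ≤ t) : g t ≤ g 0 :=
  hg.antitoneOn (mem_Ici.2 le_rfl) ht ht

lemma exists_derivWithin_bound (hg : IsDecreasingCoefficient g) :
    ∃ K : ℝ, 0 < K ∧ ∀ t, 0 ≤ t → -derivWithin g (Ici 0) t ≤ K := by
  obtain ⟨C, hC, h⟩ := hg.deriv_bound 1 (Or.inl rfl)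
  refine ⟨C * g 0, mul_pos hC (hg.pos 0 le_rfl), fun t ht => ?_⟩
  have h1 := h t ht
  rw [iteratedDerivWithin_one, pow_one] at h1
  have h2 : 1 / (1 + t) ≤ 1 := by rw [div_le_one (by linarith)]; linarith
  have h3 : C * g t ≤ C * g 0 := mul_le_mul_of_nonneg_left (hg.le_zero ht) hC.le
  have h4 : 0 ≤ C * g t := mul_nonneg hC.le (hg.pos t ht).le
  calc -derivWithin g (Ici 0) t ≤ |derivWithin g (Ici 0) t| := neg_le_abs _
    _ ≤ C * g t * (1 / (1 + t)) := h1
    _ ≤ C * g t * 1 := mul_le_mul_of_nonneg_left h2 h4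
    _ ≤ C * g 0 := by linarith

lemma intervalIntegrable (hg : IsDecreasingCoefficient g) {a b : ℝ} (ha : 0 ≤ a) (hb : 0 ≤ b) :
    IntervalIntegrable g volume a b :=
  (hg.continuousOn.mono fun _ hx => (le_inf ha hb).trans hx.1).intervalIntegrable

lemma hasDerivAt_integral (hg : IsDecreasingCoefficient g) {t : ℝ} (ht : 0 < t) :
    HasDerivAt (fun t => ∫ τ in (0 : ℝ)..t, g τ) (g t) t := by
  have hc : ∀ᶠ x in 𝓝 t, ContinuousAt g x :=
    (lt_mem_nhds ht).mono fun x hx => (hg.hasDerivAt hx).continuousAt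
  exact intervalIntegral.integral_hasDerivAt_right (hg.intervalIntegrable le_rfl ht.le)
    (ContinuousOn.stronglyMeasurableAtFilter isOpen_Ioi
      (fun x hx => (hg.hasDerivAt hx).continuousAt.continuousWithinAt) t ht)
    (hg.hasDerivAt ht).continuousAt

lemma integral_nonneg (hg : IsDecreasingCoefficient g) {t : ℝ} (ht : 0 ≤ t) :
    0 ≤ ∫ τ in (0 : ℝ)..t, g τ :=
  intervalIntegral.integral_nonneg ht fun u hu => (hg.pos u hu.1).le

lemma continuousOn_integral (hg : IsDecreasingCoefficient g) :
    ContinuousOn (fun t => ∫ τ in (0 : ℝ)..t, g τ) (Ici 0) := by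
  intro t ht
  have h0 : (0 : ℝ) ≤ t + 1 := by have := mem_Ici.1 ht; linarith
  have h1 : ContinuousOn (fun t => ∫ τ in (0 : ℝ)..t, g τ) (uIcc 0 (t + 1)) :=
    intervalIntegral.continuousOn_primitive_interval
      ((intervalIntegrable_iff' (by finiteness)).1 (hg.intervalIntegrable le_rfl h0))
  rw [uIcc_of_le h0] at h1
  refine (h1 t ⟨ht, by linarith⟩).mono_of_mem_nhdsWithin ?_
  filter_upwards [self_mem_nhdsWithin, nhdsWithin_le_nhds (Iio_mem_nhds (lt_add_one t))]
    with x hx hx' using ⟨hx, le_of_lt hx'⟩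

lemma tendsto_decayWeight (hg : IsDecreasingCoefficient g) :
    Tendsto (decayWeight g) atTop atTop := by
  refine tendsto_atTop_add_const_left _ _ ?_
  by_contra hcon
  have hmono : MonotoneOn (fun t => ∫ τ in (0 : ℝ)..t, g τ) (Ici 0) :=
    monotoneOn_of_deriv_nonneg (convex_Ici 0) hg.continuousOn_integral
      (by rw [interior_Ici]; exact fun t ht =>
        (hg.hasDerivAt_integral ht).differentiableAt.differentiableWithinAt)
      (by
        rw [interior_Ici]; intro t ht
        rw [(hg.hasDerivAt_integral ht).deriv]; exact (hg.pos t (le_of_lt ht)).le)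
  -- A monotone primitive that does not tend to infinity is bounded; since `g > 0`, this would make
  -- `g` integrable.
  have hb : ∃ M, ∀ t, 0 ≤ t → ∫ τ in (0 : ℝ)..t, g τ ≤ M := by
    by_contra hM
    push Not at hM
    refine hcon (tendsto_atTop.2 fun M => ?_)
    obtain ⟨a, ha, haM⟩ := hM M
    filter_upwards [eventually_ge_atTop a] with t hta
    exact haM.le.trans (hmono ha (ha.trans hta) hta)
  obtain ⟨M, hM⟩ := hb
  refine hg.not_integrable (integrableOn_Ioi_of_intervalIntegral_norm_bounded (l := atTop)
    (b := id) M 0 (fun i => ?_) tendsto_id ?_)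
  · rcases le_total 0 i with hi | hi
    · have := hg.intervalIntegrable le_rfl hi
      rwa [intervalIntegrable_iff_integrableOn_Ioc_of_le hi] at this
    · simp [hi]
  · filter_upwards [eventually_ge_atTop (0 : ℝ)] with i hi
    refine le_of_eq_of_le (intervalIntegral.integral_congr fun x hx => ?_) (hM i hi)
    rw [id, uIcc_of_le hi] at hx
    exact Real.norm_of_nonneg (hg.pos x hx.1).le

lemma decayWeight_rpow_isLittleO (hg : IsDecreasingCoefficient g) {r s : ℝ} (h : r < s) :
    (fun t : ℝ => decayWeight g t ^ (-s / 2)) =o[atTop]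
      (fun t : ℝ => decayWeight g t ^ (-r / 2)) := by
  have h1 : Tendsto (fun t : ℝ => decayWeight g t ^ (-((s - r) / 2))) atTop (𝓝 0) :=
    (tendsto_rpow_neg_atTop (by linarith)).comp hg.tendsto_decayWeight
  have h2 := ((Asymptotics.isLittleO_one_iff ℝ).2 h1).mul_isBigO
    (Asymptotics.isBigO_refl (fun t : ℝ => decayWeight g t ^ (-r / 2)) atTop)
  refine h2.congr' ?_ (Eventually.of_forall fun t => one_mul _)
  filter_upwards [hg.tendsto_decayWeight.eventually_gt_atTop 0] with t ht
  rw [← Real.rpow_add ht]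
  ring_nf

end IsDecreasingCoefficient

/-! ### Lyapunov functional for the abstract damped equation -/

section Energy

variable {H : Type*} [NormedAddCommGroup H] [InnerProductSpace ℝ H]

open scoped RealInnerProductSpace

/-- Exponential energy decay for the abstract damped equation `V'' + A V + g A V' = 0` along a
solution on which `A ≥ r`. -/
lemma energy_decay {g : ℝ → ℝ} (hg : IsDecreasingCoefficient g) {K ε : ℝ}
    (hK : ∀ t, 0 ≤ t → -derivWithin g (Ici 0) t ≤ K) (hε : 0 < ε)
    (hεK : ε * (1 + g 0 + g 0 ^ 2 + K) ≤ 1)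
    {r q : ℝ} (hq0 : 0 ≤ q) (hqr : q ≤ r) (hq1 : q ≤ 1)
    {A : H →L[ℝ] H} (hA : ∀ x y, ⟪A x, y⟫ = ⟪x, A y⟫) {V V' : ℝ → H}
    (hV : ∀ t, 0 < t → HasDerivAt V (V' t) t) (hVc : ContinuousOn V (Ici 0))
    (hV' : ∀ t, 0 < t → HasDerivAt V' (-(A (V t) + g t • A (V' t))) t)
    (hVc' : ContinuousOn V' (Ici 0))
    (hAV : ∀ t, 0 ≤ t → r * ‖V t‖ ^ 2 ≤ ⟪A (V t), V t⟫)
    (hAV' : ∀ t, 0 ≤ t → r * ‖V' t‖ ^ 2 ≤ ⟪A (V' t), V' t⟫) {t : ℝ} (ht : 0 ≤ t) :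
    ‖V' t‖ ^ 2 + ⟪A (V t), V t⟫ ≤
      4 * Real.exp (-(ε / 2 * q * ∫ τ in (0 : ℝ)..t, g τ)) *
        (‖V' 0‖ ^ 2 + ⟪A (V 0), V 0⟫) := by
  set I : ℝ → ℝ := fun t => ∫ τ in (0 : ℝ)..t, g τ with hI
  set g1 := derivWithin g (Ici 0) with hg1
  set g2 := derivWithin g1 (Ici 0) with hg2
  set E : ℝ → ℝ := fun t => ‖V' t‖ ^ 2 + ⟪A (V t), V t⟫ with hE
  -- Differentiating `g⟪V, V'⟫` produces `-g²⟪V, A V'⟫` and `g'⟪V, V'⟫`, which have no sign; the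
  -- last two terms of `F` are chosen to cancel them.
  set F : ℝ → ℝ := fun t => ⟪V' t, V' t⟫ + ⟪A (V t), V t⟫ + ε * q * (g t * ⟪V t, V' t⟫) +
    ε * q / 2 * (g t ^ 2 * ⟪A (V t), V t⟫) - ε * q / 2 * (g1 t * ⟪V t, V t⟫) with hF
  have hAVc : ContinuousOn (fun t => A (V t)) (Ici 0) := A.continuous.comp_continuousOn hVc
  have hFc : ContinuousOn F (Ici 0) := by
    have h1 := hg.continuousOn
    have h2 : ContinuousOn g1 (Ici 0) := hg.differentiableOn_deriv.continuousOn
    fun_prop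
  have hFd : ∀ t, 0 < t → HasDerivAt F (-(2 * g t * ⟪A (V' t), V' t⟫ - ε * q * g t * ‖V' t‖ ^ 2)
      - ε * q * g t * ⟪A (V t), V t⟫ + ε * q * (g t * g1 t * ⟪A (V t), V t⟫)
      - ε * q / 2 * (g2 t * ‖V t‖ ^ 2)) t := by
    intro t ht
    have hv := hV t ht
    have hw := hV' t ht
    have hav : HasDerivAt (fun t => A (V t)) (A (V' t)) t := A.hasFDerivAt.comp_hasDerivAt t hv
    have hgt := hg.hasDerivAt ht
    have hg1t := hg.hasDerivAt_deriv ht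
    have := ((((hw.inner ℝ hw).add (hav.inner ℝ hv)).add
      ((hgt.mul (hv.inner ℝ hw)).const_mul (ε * q))).add
      (((hgt.pow 2).mul (hav.inner ℝ hv)).const_mul (ε * q / 2))).sub
      ((hg1t.mul (hv.inner ℝ hv)).const_mul (ε * q / 2))
    refine this.congr_deriv ?_
    have e1 : ⟪V' t, A (V t)⟫ = ⟪V t, A (V' t)⟫ := by rw [← hA, real_inner_comm]
    have e2 : ⟪A (V' t), V t⟫ = ⟪V t, A (V' t)⟫ := real_inner_comm _ _
    have e3 : ⟪A (V t), V' t⟫ = ⟪V t, A (V' t)⟫ := hA _ _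
    have e4 : ⟪V' t, A (V' t)⟫ = ⟪A (V' t), V' t⟫ := real_inner_comm _ _
    have e5 : ⟪V t, A (V t)⟫ = ⟪A (V t), V t⟫ := real_inner_comm _ _
    have e6 : ⟪V' t, V t⟫ = ⟪V t, V' t⟫ := real_inner_comm _ _
    simp only [inner_neg_left, inner_neg_right, inner_add_left, inner_add_right,
      real_inner_smul_left, real_inner_smul_right, e1, e2, e3, e4, e5, e6,
      real_inner_self_eq_norm_sq, Pi.pow_apply]
    simp only [← hg1, ← hg2]
    ring
  have hg0 : 0 < g 0 := hg.pos 0 le_rfl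
  have hK0 : 0 ≤ K := (neg_nonneg.2 (hg.derivWithin_nonpos le_rfl)).trans (hK 0 le_rfl)
  have hr0 : 0 ≤ r := hq0.trans hqr
  have hE0 : ∀ t, 0 ≤ t → 0 ≤ ⟪A (V t), V t⟫ := fun t ht =>
    (mul_nonneg hr0 (sq_nonneg _)).trans (hAV t ht)
  have hcross : ∀ t, 0 ≤ t → |ε * q * (g t * ⟪V t, V' t⟫)| ≤ E t / 2 := by
    intro t ht
    have hgt := (hg.pos t ht)
    rw [abs_mul, abs_of_nonneg (mul_nonneg hε.le hq0), abs_mul, abs_of_pos hgt]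
    have h1 : |⟪V t, V' t⟫| ≤ ‖V t‖ * ‖V' t‖ := abs_real_inner_le_norm _ _
    have h2 : ε * g t ≤ 1 := by
      have := hg.le_zero ht
      nlinarith [sq_nonneg (g 0), mul_nonneg hε.le hK0, mul_nonneg hε.le (sq_nonneg (g 0))]
    -- Here `q² ≤ q ≤ r`, by `q ≤ 1` and `q ≤ r`.
    have h3 : q ^ 2 * ‖V t‖ ^ 2 ≤ ⟪A (V t), V t⟫ :=
      (mul_le_mul_of_nonneg_right (by nlinarith) (sq_nonneg _)).trans (hAV t ht)
    have h4 : q * (‖V t‖ * ‖V' t‖) ≤ E t / 2 := by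
      simp only [hE]; nlinarith [sq_nonneg (q * ‖V t‖ - ‖V' t‖)]
    calc ε * q * (g t * |⟪V t, V' t⟫|) = (ε * g t) * (q * |⟪V t, V' t⟫|) := by ring
      _ ≤ 1 * (q * (‖V t‖ * ‖V' t‖)) := by gcongr
      _ ≤ E t / 2 := by linarith
  have hFlow : ∀ t, 0 ≤ t → E t ≤ 2 * F t := by
    intro t ht
    have h1 := (abs_le.1 (hcross t ht)).1
    have h2 : 0 ≤ ε * q / 2 * (g t ^ 2 * ⟪A (V t), V t⟫) :=
      mul_nonneg (by positivity) (mul_nonneg (sq_nonneg _) (hE0 t ht))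
    have h3 : ε * q / 2 * (g1 t * ⟪V t, V t⟫) ≤ 0 :=
      mul_nonpos_of_nonneg_of_nonpos (by positivity)
        (mul_nonpos_of_nonpos_of_nonneg (hg.derivWithin_nonpos ht) real_inner_self_nonneg)
    simp only [hE, hF, real_inner_self_eq_norm_sq] at h1 h3 ⊢
    linarith
  have hFup : ∀ t, 0 ≤ t → F t ≤ 2 * E t := by
    intro t ht
    have h1 := (abs_le.1 (hcross t ht)).2
    have hgt := (hg.pos t ht)
    have h2 : ε * q / 2 * (g t ^ 2 * ⟪A (V t), V t⟫) ≤
        ε * 1 / 2 * (g 0 ^ 2 * ⟪A (V t), V t⟫) := by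
      have := hE0 t ht
      have := hg.le_zero ht
      gcongr
    have h3 : ε * q / 2 * (-g1 t * ‖V t‖ ^ 2) ≤ ε / 2 * (K * ⟪A (V t), V t⟫) := by
      have a1 : q * ‖V t‖ ^ 2 ≤ ⟪A (V t), V t⟫ :=
        (mul_le_mul_of_nonneg_right hqr (sq_nonneg _)).trans (hAV t ht)
      have a2 := hK t ht
      calc ε * q / 2 * (-g1 t * ‖V t‖ ^ 2) = ε / 2 * (-g1 t * (q * ‖V t‖ ^ 2)) := by ring
        _ ≤ ε / 2 * (K * ⟪A (V t), V t⟫) := by gcongr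
    have h4 : ε * (g 0 ^ 2 + K) * ⟪A (V t), V t⟫ ≤ 1 * ⟪A (V t), V t⟫ :=
      mul_le_mul_of_nonneg_right (by nlinarith) (hE0 t ht)
    simp only [hE, hF, real_inner_self_eq_norm_sq] at h1 ⊢
    nlinarith [sq_nonneg ‖V' t‖]
  -- Integrating factor: `F' ≤ -ε q g E` and `F ≤ 2E` give `F' ≤ -(ε/2) q g F`.
  set Φ : ℝ → ℝ := fun t => Real.exp (ε / 2 * q * I t) * F t with hΦ
  have hanti : AntitoneOn Φ (Ici 0) := by
    have hder : ∀ t, 0 < t → HasDerivAt Φ _ t := fun t ht =>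
      (((hg.hasDerivAt_integral ht).const_mul (ε / 2 * q)).exp).mul (hFd t ht)
    refine antitoneOn_of_deriv_nonpos (convex_Ici 0) ?_ ?_ ?_
    · have := hg.continuousOn_integral
      fun_prop
    · rw [interior_Ici]
      exact fun t ht => (hder t ht).differentiableAt.differentiableWithinAt
    · rw [interior_Ici]
      intro t ht
      have ht' : 0 ≤ t := le_of_lt ht
      rw [(hder t ht).deriv, mul_assoc, ← mul_add]
      refine mul_nonpos_of_nonneg_of_nonpos (Real.exp_pos _).le ?_
      have hgt := (hg.pos t ht')
      have h1 : ε / 2 * q * g t * F t ≤ ε / 2 * q * g t * (2 * E t) :=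
        mul_le_mul_of_nonneg_left (hFup t ht') (by positivity)
      have h2 : g t * (q * ‖V' t‖ ^ 2) ≤ g t * ⟪A (V' t), V' t⟫ :=
        mul_le_mul_of_nonneg_left
          ((mul_le_mul_of_nonneg_right hqr (sq_nonneg _)).trans (hAV' t ht')) hgt.le
      have h3 : ε * q * (g t * g1 t * ⟪A (V t), V t⟫) ≤ 0 := by
        have : g t * g1 t * ⟪A (V t), V t⟫ ≤ 0 :=
          mul_nonpos_of_nonpos_of_nonneg
            (mul_nonpos_of_nonneg_of_nonpos hgt.le (hg.derivWithin_nonpos ht')) (hE0 t ht')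
        exact mul_nonpos_of_nonneg_of_nonpos (by positivity) this
      have h4 : 0 ≤ ε * q / 2 * (g2 t * ‖V t‖ ^ 2) :=
        mul_nonneg (by positivity) (mul_nonneg (hg.derivWithin_two_nonneg ht') (sq_nonneg _))
      have hε1 : ε ≤ 1 := by
        nlinarith [mul_nonneg hε.le hg0.le, mul_nonneg hε.le (sq_nonneg (g 0)),
          mul_nonneg hε.le hK0]
      have h5 : ε * (g t * (q * ‖V' t‖ ^ 2)) ≤ 1 * (g t * (q * ‖V' t‖ ^ 2)) :=
        mul_le_mul_of_nonneg_right hε1 (by positivity)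
      simp only [hE] at h1
      nlinarith
  have h0 := hanti (mem_Ici.2 le_rfl) ht ht
  have hI0 : I 0 = 0 := by simp [hI]
  simp only [hΦ, hI0, mul_zero, Real.exp_zero, one_mul] at h0
  have h1 : F t ≤ Real.exp (-(ε / 2 * q * I t)) * F 0 := by
    rw [Real.exp_neg, inv_mul_eq_div, le_div_iff₀ (Real.exp_pos _)]
    linarith
  calc E t ≤ 2 * F t := hFlow t ht
    _ ≤ 2 * (Real.exp (-(ε / 2 * q * I t)) * (2 * E 0)) := by
      gcongr
      exact h1.trans (mul_le_mul_of_nonneg_left (hFup 0 le_rfl) (Real.exp_pos _).le)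
    _ = _ := by simp only [hE, hI]; ring

end Energy

/-! ### From weak to norm differentiability -/

section WeakDerivative

variable {X : Type*} [NormedAddCommGroup X] [NormedSpace ℝ X] [CompleteSpace X]

/-- A curve whose compositions with a separating family of continuous functionals are
differentiable, with a continuous candidate derivative, is differentiable in norm. -/
lemma hasDerivAt_of_weak {ι Y : Type*} [NormedAddCommGroup Y] [NormedSpace ℝ Y]
    (ℓ : ι → X →L[ℝ] Y) (hℓ : ∀ x, (∀ i, ℓ i x = 0) → x = 0)
    {f W : ℝ → X} (hW : ContinuousOn W (Ioi 0))
    (h : ∀ i, ∀ t, 0 < t → HasDerivAt (fun τ => ℓ i (f τ)) (ℓ i (W t)) t) {t : ℝ} (ht : 0 < t) :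
    HasDerivAt f (W t) t := by
  have hF : ∀ s, 0 < s → HasDerivAt (fun s => ∫ τ in t..s, W τ) (W s) s := by
    intro s hs
    refine intervalIntegral.integral_hasDerivAt_right ?_
      (hW.stronglyMeasurableAtFilter isOpen_Ioi s hs) (hW.continuousAt (Ioi_mem_nhds hs))
    exact (hW.mono fun x hx => (lt_inf_iff.2 ⟨ht, hs⟩).trans_le hx.1).intervalIntegrable
  -- Each functional sees `f` minus the primitive of `W` as constant, and the functionals separate
  -- points.
  have hconst : ∀ s, 0 < s → f s = (∫ τ in t..s, W τ) + f t := by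
    intro s hs
    rw [← sub_eq_zero]
    refine hℓ _ fun i => ?_
    have hd : ∀ s ∈ Ioi (0 : ℝ),
        HasDerivAt (fun s => ℓ i (f s) - ℓ i (∫ τ in t..s, W τ)) 0 s := by
      intro s hs
      have := (h i s hs).sub ((ℓ i).hasFDerivAt.comp_hasDerivAt s (hF s hs))
      rwa [sub_self] at this
    have := isOpen_Ioi.is_const_of_deriv_eq_zero (isPreconnected_Ioi)
      (fun s hs => (hd s hs).differentiableAt.differentiableWithinAt)
      (fun s hs => (hd s hs).deriv) (mem_Ioi.2 hs) (mem_Ioi.2 ht)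
    simp only [intervalIntegral.integral_same, map_zero, sub_zero] at this
    rw [map_sub, map_add, ← this]
    abel
  refine ((hF t ht).add_const (f t)).congr_of_eventuallyEq ?_
  filter_upwards [lt_mem_nhds ht] with s hs using hconst s hs

end WeakDerivative

/-! ### Bounded multiplication operators on `L²` -/

section Multiplication

variable {n : ℕ}

/-- Multiplication by an essentially bounded real function, as an operator on `L²`. -/
def mulOp (m : EuclideanSpace ℝ (Fin n) → ℝ) (hm : MemLp (fun ξ => (m ξ : ℂ)) ⊤ volume) :
    L2 n →L[ℂ] L2 n :=
  (ContinuousLinearMap.lsmul ℂ ℂ).holderL volume ⊤ 2 2 (hm.toLp _)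

lemma coeFn_mulOp {m : EuclideanSpace ℝ (Fin n) → ℝ}
    (hm : MemLp (fun ξ => (m ξ : ℂ)) ⊤ volume) (f : L2 n) :
    mulOp m hm f =ᵐ[volume] fun ξ => (m ξ : ℂ) * f ξ := by
  have h := ContinuousLinearMap.coeFn_holder (r := 2) (ContinuousLinearMap.lsmul ℂ ℂ)
    (hm.toLp _) f
  filter_upwards [h, hm.coeFn_toLp] with ξ h1 h2
  rw [mulOp, ContinuousLinearMap.holderL_apply_apply, h1, h2]
  simp

lemma mulOp_mulOp {m₁ m₂ m₃ : EuclideanSpace ℝ (Fin n) → ℝ}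
    (h₁ : MemLp (fun ξ => (m₁ ξ : ℂ)) ⊤ volume) (h₂ : MemLp (fun ξ => (m₂ ξ : ℂ)) ⊤ volume)
    (h₃ : MemLp (fun ξ => (m₃ ξ : ℂ)) ⊤ volume) (h : ∀ ξ, m₁ ξ * m₂ ξ = m₃ ξ) (f : L2 n) :
    mulOp m₁ h₁ (mulOp m₂ h₂ f) = mulOp m₃ h₃ f := by
  apply Lp.ext
  filter_upwards [coeFn_mulOp h₁ (mulOp m₂ h₂ f), coeFn_mulOp h₂ f, coeFn_mulOp h₃ f]
    with ξ a b c
  rw [a, b, c, ← h]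
  push_cast; ring

lemma inner_mulOp {m : EuclideanSpace ℝ (Fin n) → ℝ}
    (hm : MemLp (fun ξ => (m ξ : ℂ)) ⊤ volume) (f h : L2 n) :
    inner ℝ (mulOp m hm f) h = ∫ ξ, m ξ * inner ℝ (f ξ) (h ξ) := by
  rw [L2.inner_def]
  refine integral_congr_ae ?_
  filter_upwards [coeFn_mulOp hm f] with ξ a
  simp only [a, ← Complex.real_smul, real_inner_smul_left]

lemma mulOp_symm {m : EuclideanSpace ℝ (Fin n) → ℝ}
    (hm : MemLp (fun ξ => (m ξ : ℂ)) ⊤ volume) (f h : L2 n) :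
    inner ℝ (mulOp m hm f) h = inner ℝ f (mulOp m hm h) := by
  rw [inner_mulOp, real_inner_comm, inner_mulOp]
  simp only [real_inner_comm]

lemma norm_sq_eq_integral (f : L2 n) : ‖f‖ ^ 2 = ∫ ξ, ‖f ξ‖ ^ 2 := by
  rw [← real_inner_self_eq_norm_sq, L2.inner_def]
  simp only [real_inner_self_eq_norm_sq]

lemma integrable_norm_sq (f : L2 n) : Integrable (fun ξ => ‖f ξ‖ ^ 2) volume :=
  (memLp_two_iff_integrable_sq_norm (Lp.aestronglyMeasurable f)).1 (Lp.memLp f)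

end Multiplication

/-! ### The equation on the Fourier side -/

section FourierSide

variable {n : ℕ}

/-- A cutoff multiplier applied to the Fourier transform of the distributional Laplacian. -/
lemma laplacian_apply_fourier_smul (f : L2 n) {η : EuclideanSpace ℝ (Fin n) → ℂ}
    (hη : η.HasTemperateGrowth) (ψ : 𝓢(EuclideanSpace ℝ (Fin n), ℂ)) :
    Δ (f : 𝓢'(EuclideanSpace ℝ (Fin n), ℂ)) (𝓕 (SchwartzMap.smulLeftCLM ℂ η ψ)) =
      ∫ ξ, (-((2 * Real.pi * ‖ξ‖) ^ 2 : ℝ) * η ξ * ψ ξ) * (𝓕 f : L2 n) ξ := by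
  have hn : Function.HasTemperateGrowth
    (fun x : EuclideanSpace ℝ (Fin n) => Complex.ofReal (‖x‖ ^ 2)) := by fun_prop
  rw [← TemperedDistribution.fourier_apply,
    TemperedDistribution.laplacian_eq_fourierMultiplierCLM, ← Complex.coe_smul,
    FourierTransform.fourier_smul,
    TemperedDistribution.fourierMultiplierCLM_apply, FourierTransform.fourier_fourierInv_eq,
    Lp.fourier_toTemperedDistribution_eq, smul_apply,
    TemperedDistribution.smulLeftCLM_apply_apply, Lp.toTemperedDistribution_apply,
    ← integral_smul]
  refine integral_congr_ae (Eventually.of_forall fun ξ => ?_)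
  simp only [SchwartzMap.smulLeftCLM_apply_apply hn, SchwartzMap.smulLeftCLM_apply_apply hη,
    smul_eq_mul]
  push_cast
  ring

lemma apply_fourier_smul (f : L2 n) {η : EuclideanSpace ℝ (Fin n) → ℂ}
    (hη : η.HasTemperateGrowth) (ψ : 𝓢(EuclideanSpace ℝ (Fin n), ℂ)) :
    (f : 𝓢'(EuclideanSpace ℝ (Fin n), ℂ)) (𝓕 (SchwartzMap.smulLeftCLM ℂ η ψ)) =
      ∫ ξ, (η ξ * ψ ξ) * (𝓕 f : L2 n) ξ := by
  rw [← TemperedDistribution.fourier_apply, Lp.fourier_toTemperedDistribution_eq,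
    Lp.toTemperedDistribution_apply]
  simp [SchwartzMap.smulLeftCLM_apply_apply hη]

lemma mulOp_apply_schwartz {m : EuclideanSpace ℝ (Fin n) → ℝ}
    (hm : MemLp (fun ξ => (m ξ : ℂ)) ⊤ volume) (f : L2 n)
    (ψ : 𝓢(EuclideanSpace ℝ (Fin n), ℂ)) :
    (mulOp m hm f : 𝓢'(EuclideanSpace ℝ (Fin n), ℂ)) ψ = ∫ ξ, (m ξ * ψ ξ) * f ξ := by
  rw [Lp.toTemperedDistribution_apply]
  refine integral_congr_ae ?_
  filter_upwards [coeFn_mulOp hm f] with ξ a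
  simp only [a, smul_eq_mul]
  ring

/-- After a smooth frequency cutoff, the equation holds in the norm of `L²`. -/
lemma IsSobolevSolution.hasDerivAt_mulOp_fourier {g : ℝ → ℝ} (hg : ContinuousOn g (Ici 0))
    {u₀ u₁ : L2 n} {u ut : ℝ → L2 n} (hu : IsSobolevSolution g u₀ u₁ u ut)
    {η m : EuclideanSpace ℝ (Fin n) → ℝ} (hηt : (fun ξ => (η ξ : ℂ)).HasTemperateGrowth)
    (hη : MemLp (fun ξ => (η ξ : ℂ)) ⊤ volume) (hm : MemLp (fun ξ => (m ξ : ℂ)) ⊤ volume)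
    (hmη : ∀ ξ, m ξ = -(2 * Real.pi * ‖ξ‖) ^ 2 * η ξ) {t : ℝ} (ht : 0 < t) :
    HasDerivAt (fun τ => mulOp η hη (𝓕 (ut τ)))
      (mulOp m hm (𝓕 (u t) + g t • 𝓕 (ut t))) t := by
  have hFc : Continuous (fun f : L2 n => (𝓕 f : L2 n)) :=
    FourierTransform.continuous_fourier
  have huc : ContinuousOn u (Ici 0) := fun t ht => (hu.hasDeriv t ht).continuousWithinAt
  have key : ∀ (f : L2 n) (ψ : 𝓢(EuclideanSpace ℝ (Fin n), ℂ)),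
      (mulOp m hm (𝓕 f) : 𝓢'(EuclideanSpace ℝ (Fin n), ℂ)) ψ =
      Δ (f : 𝓢'(EuclideanSpace ℝ (Fin n), ℂ))
        (𝓕 (SchwartzMap.smulLeftCLM ℂ (fun ξ => (η ξ : ℂ)) ψ)) := by
    intro f ψ
    rw [laplacian_apply_fourier_smul f hηt, mulOp_apply_schwartz]
    refine integral_congr_ae (Eventually.of_forall fun ξ => ?_)
    simp only [hmη]
    push_cast
    ring
  let ℓ : 𝓢(EuclideanSpace ℝ (Fin n), ℂ) → L2 n →L[ℂ] ℂ := fun ψ =>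
    (PointwiseConvergenceCLM.evalCLM (RingHom.id ℂ) ℂ ψ).comp
      (Lp.toTemperedDistributionCLM ℂ volume 2)
  have hℓ : ∀ ψ f, ℓ ψ f = (f : 𝓢'(EuclideanSpace ℝ (Fin n), ℂ)) ψ := fun _ _ => rfl
  refine hasDerivAt_of_weak (fun ψ => (ℓ ψ).restrictScalars ℝ)
    (W := fun t => mulOp m hm (𝓕 (u t) + g t • 𝓕 (ut t))) ?_ ?_ ?_ ht
  -- Schwartz functions separate points because `L²` embeds injectively into tempered distributions.
  · intro f hf
    have h0 : f ∈ (Lp.toTemperedDistributionCLM ℂ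
        (volume : Measure (EuclideanSpace ℝ (Fin n))) 2).ker := by
      rw [LinearMap.mem_ker]
      ext ψ
      exact hf ψ
    rwa [Lp.ker_toTemperedDistributionCLM_eq_bot, Submodule.mem_bot] at h0
  · refine ContinuousOn.mono ?_ Ioi_subset_Ici_self
    exact (mulOp m hm).continuous.comp_continuousOn ((hFc.comp_continuousOn huc).add
      (hg.smul (hFc.comp_continuousOn hu.continuousOn_deriv)))
  · intro ψ s hs
    have h := hu.equation s hs (𝓕 (SchwartzMap.smulLeftCLM ℂ (fun ξ => (η ξ : ℂ)) ψ))
    refine (h.congr_of_eventuallyEq (Eventually.of_forall fun τ => ?_)).congr_deriv ?_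
    · simp only [ContinuousLinearMap.coe_restrictScalars', hℓ]
      rw [apply_fourier_smul _ hηt, mulOp_apply_schwartz]
    · rw [← key, ← key, ContinuousLinearMap.coe_restrictScalars', map_add,
        ContinuousLinearMap.map_smul_of_tower, map_add,
        ContinuousLinearMap.map_smul_of_tower, hℓ, hℓ, Complex.real_smul]

end FourierSide

/-! ### Energy decay on bounded frequency sets -/

section FrequencyEnergy

variable {n : ℕ}

/-- The energy of the Fourier transform on a bounded set of frequencies decays. -/
lemma IsSobolevSolution.setIntegral_energy_le {g : ℝ → ℝ} (hg : IsDecreasingCoefficient g)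
    {K ε : ℝ} (hK : ∀ t, 0 ≤ t → -derivWithin g (Ici 0) t ≤ K) (hε : 0 < ε)
    (hεK : ε * (1 + g 0 + g 0 ^ 2 + K) ≤ 1)
    {u₀ u₁ : L2 n} {u ut : ℝ → L2 n} (hu : IsSobolevSolution g u₀ u₁ u ut)
    {S : Set (EuclideanSpace ℝ (Fin n))} (hS : MeasurableSet S) {R r : ℝ} (hr : 0 ≤ r)
    (hSR : ∀ ξ ∈ S, ‖ξ‖ ≤ R) (hSr : ∀ ξ ∈ S, r ≤ (2 * Real.pi * ‖ξ‖) ^ 2) {t : ℝ}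
    (ht : 0 ≤ t) :
    ∫ ξ in S, (‖(𝓕 (ut t) : L2 n) ξ‖ ^ 2 +
        (2 * Real.pi * ‖ξ‖) ^ 2 * ‖(𝓕 (u t) : L2 n) ξ‖ ^ 2) ≤
      4 * Real.exp (-(ε / 2 * (r / (1 + r)) * ∫ τ in (0 : ℝ)..t, g τ)) *
        ∫ ξ in S, (‖(𝓕 u₁ : L2 n) ξ‖ ^ 2 +
          (2 * Real.pi * ‖ξ‖) ^ 2 * ‖(𝓕 u₀ : L2 n) ξ‖ ^ 2) := by
  obtain ⟨R', hR', hRR'⟩ : ∃ R' : ℝ, 0 < R' ∧ R ≤ R' :=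
    ⟨max R 1, lt_max_of_lt_right one_pos, le_max_left _ _⟩
  -- Two cutoffs are used: the smooth `η`, equal to 1 on `S`, can be multiplied into test functions,
  -- while the indicator `χ` of `S` restricts the energy to `S` exactly. Since `χ η = χ`, the
  -- equation obtained with `η` passes to `χ`.
  let η : ContDiffBump (0 : EuclideanSpace ℝ (Fin n)) := ⟨R', R' + 1, hR', by linarith⟩
  have hη1 : ∀ ξ ∈ S, η ξ = 1 := fun ξ hξ =>
    η.one_of_mem_closedBall (by simpa using (hSR ξ hξ).trans hRR')
  have hηt : (fun ξ => (η ξ : ℂ)).HasTemperateGrowth := by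
    refine HasCompactSupport.hasTemperateGrowth ?_ ?_
    · exact η.hasCompactSupport.comp_left (g := Complex.ofReal) Complex.ofReal_zero
    · exact Complex.ofRealCLM.contDiff.comp η.contDiff
  have hηm : MemLp (fun ξ => (η ξ : ℂ)) ⊤ volume :=
    Continuous.memLp_top_of_hasCompactSupport (Complex.continuous_ofReal.comp η.continuous)
      (η.hasCompactSupport.comp_left (g := Complex.ofReal) Complex.ofReal_zero) _
  have hmm : MemLp (fun ξ => ((-(2 * Real.pi * ‖ξ‖) ^ 2 * η ξ : ℝ) : ℂ)) ⊤ volume := by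
    refine Continuous.memLp_top_of_hasCompactSupport ?_ ?_ _
    · have := η.continuous
      fun_prop
    · exact HasCompactSupport.comp_left (g := Complex.ofReal)
        (η.hasCompactSupport.mul_left (f := fun ξ => -(2 * Real.pi * ‖ξ‖) ^ 2))
        Complex.ofReal_zero
  set χ : EuclideanSpace ℝ (Fin n) → ℝ := S.indicator 1 with hχ
  set a : EuclideanSpace ℝ (Fin n) → ℝ := fun ξ => (2 * Real.pi * ‖ξ‖) ^ 2 * χ ξ with ha
  have hχm : MemLp (fun ξ => (χ ξ : ℂ)) ⊤ volume := by
    refine memLp_top_of_bound ?_ 1 (Eventually.of_forall fun ξ => ?_)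
    · exact (Complex.measurable_ofReal.comp (measurable_one.indicator hS)).aestronglyMeasurable
    · by_cases h : ξ ∈ S <;> simp [hχ, h]
  have ham : MemLp (fun ξ => (a ξ : ℂ)) ⊤ volume := by
    refine memLp_top_of_bound ?_ ((2 * Real.pi * R') ^ 2) (Eventually.of_forall fun ξ => ?_)
    · refine (Complex.measurable_ofReal.comp ?_).aestronglyMeasurable
      exact Measurable.mul (by fun_prop) (measurable_one.indicator hS)
    · by_cases h : ξ ∈ S
      · have := (hSR ξ h).trans hRR'
        simp only [ha, hχ, h, indicator_of_mem, Pi.one_apply, mul_one, Complex.norm_real,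
          Real.norm_eq_abs, abs_pow, abs_mul, abs_norm, abs_of_pos Real.pi_pos,
          abs_of_pos (two_pos : (0 : ℝ) < 2)]
        gcongr
      · simp only [ha, hχ, h, not_false_eq_true, indicator_of_notMem, mul_zero,
          Complex.ofReal_zero, norm_zero]
        positivity
  set A : L2 n →L[ℝ] L2 n := (mulOp a ham).restrictScalars ℝ with hA
  set P : L2 n →L[ℝ] L2 n := (mulOp χ hχm).restrictScalars ℝ with hP
  set Fo : L2 n →L[ℝ] L2 n :=
    ((FourierTransform.fourierCLM ℂ (L2 n)).restrictScalars ℝ) with hFo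
  have hFo' : ∀ f : L2 n, Fo f = 𝓕 f := fun _ => rfl
  have hχχ : ∀ ξ, χ ξ * χ ξ = χ ξ := fun ξ => by by_cases h : ξ ∈ S <;> simp [hχ, h]
  have hAP : ∀ f, A (P f) = A f := fun f =>
    mulOp_mulOp ham hχm ham (fun ξ => by rw [ha]; simp only; rw [mul_assoc, hχχ]) f
  have hPP : ∀ f, P (P f) = P f := fun f => mulOp_mulOp hχm hχm hχm hχχ f
  have hPη : ∀ f, P (mulOp η hηm f) = P f := fun f =>
    mulOp_mulOp hχm hηm hχm (fun ξ => by
      by_cases h : ξ ∈ S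
      · rw [hη1 ξ h, mul_one]
      · simp [hχ, h]) f
  have hPm : ∀ f, P (mulOp _ hmm f) = -A f := by
    intro f
    apply Lp.ext
    have e1 := coeFn_mulOp hχm (mulOp _ hmm f)
    filter_upwards [e1, coeFn_mulOp hmm f, coeFn_mulOp ham f, Lp.coeFn_neg (A f)]
      with ξ h1 h2 h3 h4
    rw [h4]
    simp only [hP, hA, ContinuousLinearMap.coe_restrictScalars', Pi.neg_apply]
    rw [h1, h2, h3]
    by_cases h : ξ ∈ S
    · simp only [ha, hη1 ξ h]
      push_cast; ring
    · simp [ha, hχ, h]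
  have hinner : ∀ f : L2 n, inner ℝ (A (P f)) (P f) =
      ∫ ξ in S, (2 * Real.pi * ‖ξ‖) ^ 2 * ‖f ξ‖ ^ 2 := by
    intro f
    rw [hA, ContinuousLinearMap.coe_restrictScalars', inner_mulOp, ← integral_indicator hS]
    refine integral_congr_ae ?_
    filter_upwards [coeFn_mulOp hχm f] with ξ h1
    simp only [real_inner_self_eq_norm_sq, hP, ContinuousLinearMap.coe_restrictScalars', h1]
    by_cases h : ξ ∈ S <;> simp [ha, hχ, h]
  have hnorm : ∀ f : L2 n, ‖P f‖ ^ 2 = ∫ ξ in S, ‖f ξ‖ ^ 2 := by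
    intro f
    rw [norm_sq_eq_integral, ← integral_indicator hS]
    refine integral_congr_ae ?_
    filter_upwards [coeFn_mulOp hχm f] with ξ h1
    simp only [hP, ContinuousLinearMap.coe_restrictScalars', h1]
    by_cases h : ξ ∈ S <;> simp [hχ, h]
  have hint : ∀ f : L2 n, IntegrableOn (fun ξ => (2 * Real.pi * ‖ξ‖) ^ 2 * ‖f ξ‖ ^ 2) S := by
    intro f
    refine Integrable.mono' ((integrable_norm_sq f).const_mul ((2 * Real.pi * R') ^ 2)).integrableOn
      ?_ ?_
    · exact (AEStronglyMeasurable.mul (by fun_prop)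
        ((Lp.aestronglyMeasurable f).norm.pow 2)).restrict
    · filter_upwards [ae_restrict_mem hS] with ξ hξ
      have := (hSR ξ hξ).trans hRR'
      rw [Real.norm_of_nonneg (by positivity)]
      gcongr
  have hlow : ∀ f : L2 n, r * ‖P f‖ ^ 2 ≤ inner ℝ (A (P f)) (P f) := by
    intro f
    rw [hinner, hnorm, ← integral_const_mul]
    refine setIntegral_mono_on ((integrable_norm_sq f).integrableOn.const_mul r) (hint f) hS ?_
    intro ξ hξ
    exact mul_le_mul_of_nonneg_right (hSr ξ hξ) (sq_nonneg _)
  have hsum : ∀ f h : L2 n, ‖P f‖ ^ 2 + inner ℝ (A (P h)) (P h) =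
      ∫ ξ in S, (‖f ξ‖ ^ 2 + (2 * Real.pi * ‖ξ‖) ^ 2 * ‖h ξ‖ ^ 2) := by
    intro f h
    rw [hinner, hnorm, integral_add (integrable_norm_sq f).integrableOn (hint h)]
  have hr1 : 0 < 1 + r := by linarith
  -- The choice `q = r/(1+r)` satisfies both `q ≤ r` and `q ≤ 1`.
  have := energy_decay hg hK hε hεK (r := r) (q := r / (1 + r)) (by positivity)
    (div_le_self hr (by linarith)) ((div_le_one hr1).2 (by linarith))
    (A := A) (fun x y => mulOp_symm ham x y)
    (V := fun t => P (Fo (u t))) (V' := fun t => P (Fo (ut t))) ?_ ?_ ?_ ?_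
    (fun t _ => hlow _) (fun t _ => hlow _) ht
  · rw [hsum, hsum, hu.initial, hu.initial_deriv] at this
    exact this
  · intro t ht
    have h1 := (hu.hasDeriv t ht.le).hasDerivAt (Ici_mem_nhds ht)
    exact (P.comp Fo).hasFDerivAt.comp_hasDerivAt t h1
  · exact (P.comp Fo).continuous.comp_continuousOn
      fun t ht => (hu.hasDeriv t ht).continuousWithinAt
  · intro t ht
    have h1 := hu.hasDerivAt_mulOp_fourier hg.continuousOn hηt hηm hmm (fun _ => rfl) ht
    have h2 := P.hasFDerivAt.comp_hasDerivAt t h1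
    refine (h2.congr_of_eventuallyEq (Eventually.of_forall fun τ => ?_)).congr_deriv ?_
    · exact (hPη _).symm
    · rw [hPm, hAP, hAP, map_add, map_smul]
      rfl
  · exact (P.comp Fo).continuous.comp_continuousOn hu.continuousOn_deriv

end FrequencyEnergy

/-! ### Energy decay at almost every frequency -/

section Pointwise

variable {n : ℕ}

/-- Rational lower bounds for `ρ²` keep the exceptional null sets countable in number; losing a
factor 2 in the bound costs at most half of the exponential rate. -/
lemma exists_rat_half_le {y : ℝ} (hy : 0 ≤ y) : ∃ r : ℚ, 0 ≤ r ∧ y / 2 ≤ r ∧ (r : ℝ) ≤ y := by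
  rcases hy.eq_or_lt with rfl | hy
  · exact ⟨0, le_rfl, by simp, by simp⟩
  · obtain ⟨r, h1, h2⟩ := exists_rat_btwn (half_lt_self hy)
    exact ⟨r, by exact_mod_cast ((half_pos hy).trans h1).le, h1.le, h2.le⟩

lemma half_div_one_add_le {y r : ℝ} (hy : 0 ≤ y) (h1 : y / 2 ≤ r) :
    y / (1 + y) / 2 ≤ r / (1 + r) := by
  rw [div_div, div_le_div_iff₀ (by positivity) (by linarith)]
  nlinarith

/-- The energy of the Fourier transform decays at almost every frequency. -/
lemma IsDecreasingCoefficient.exists_ae_energy_le {g : ℝ → ℝ} (hg : IsDecreasingCoefficient g) :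
    ∃ c : ℝ, 0 < c ∧ ∀ (u₀ u₁ : L2 n) (u ut : ℝ → L2 n), IsSobolevSolution g u₀ u₁ u ut →
      ∀ t, 0 ≤ t → ∀ᵐ ξ : EuclideanSpace ℝ (Fin n),
        ‖(𝓕 (ut t) : L2 n) ξ‖ ^ 2 + (2 * Real.pi * ‖ξ‖) ^ 2 * ‖(𝓕 (u t) : L2 n) ξ‖ ^ 2 ≤
        4 * Real.exp (-(c * ((2 * Real.pi * ‖ξ‖) ^ 2 / (1 + (2 * Real.pi * ‖ξ‖) ^ 2)) *
            ∫ τ in (0 : ℝ)..t, g τ)) *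
          (‖(𝓕 u₁ : L2 n) ξ‖ ^ 2 + (2 * Real.pi * ‖ξ‖) ^ 2 * ‖(𝓕 u₀ : L2 n) ξ‖ ^ 2) := by
  obtain ⟨K, hK0, hK⟩ := hg.exists_derivWithin_bound
  have hg0 := hg.pos 0 le_rfl
  have hden : 0 < 1 + g 0 + g 0 ^ 2 + K := by positivity
  set ε := 1 / (1 + g 0 + g 0 ^ 2 + K) with hε
  have hε0 : 0 < ε := by positivity
  -- The rate `ε/2` of the energy estimate, halved by the rational approximation of `ρ²`.
  refine ⟨ε / 4, by positivity, fun u₀ u₁ u ut hu t ht => ?_⟩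
  set e : L2 n → L2 n → EuclideanSpace ℝ (Fin n) → ℝ := fun f h ξ =>
    ‖(𝓕 f : L2 n) ξ‖ ^ 2 + (2 * Real.pi * ‖ξ‖) ^ 2 * ‖(𝓕 h : L2 n) ξ‖ ^ 2 with he
  set I := ∫ τ in (0 : ℝ)..t, g τ with hI
  have hI0 : 0 ≤ I := hg.integral_nonneg ht
  have hae : ∀ (r : ℚ) (R : ℕ), ∀ᵐ ξ : EuclideanSpace ℝ (Fin n), 0 ≤ r → ‖ξ‖ ≤ R →
      (r : ℝ) ≤ (2 * Real.pi * ‖ξ‖) ^ 2 →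
      e (ut t) (u t) ξ ≤ 4 * Real.exp (-(ε / 2 * (r / (1 + r)) * I)) * e u₁ u₀ ξ := by
    intro r R
    by_cases hr : 0 ≤ r
    swap
    · exact Eventually.of_forall fun ξ h => absurd h hr
    set T : Set (EuclideanSpace ℝ (Fin n)) :=
      {ξ | ‖ξ‖ ≤ R ∧ (r : ℝ) ≤ (2 * Real.pi * ‖ξ‖) ^ 2} with hT
    have hTm : MeasurableSet T := by
      refine MeasurableSet.inter ?_ ?_
      · exact measurableSet_le measurable_norm measurable_const
      · exact measurableSet_le measurable_const
          (((measurable_const.mul measurable_norm)).pow_const 2)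
    have hint : ∀ f h : L2 n, IntegrableOn (e f h) T := by
      intro f h
      refine Integrable.mono' (((integrable_norm_sq (𝓕 f : L2 n)).add
        ((integrable_norm_sq (𝓕 h : L2 n)).const_mul ((2 * Real.pi * R) ^ 2))).integrableOn) ?_ ?_
      · exact (AEStronglyMeasurable.add ((Lp.aestronglyMeasurable _).norm.pow 2)
          (AEStronglyMeasurable.mul (by fun_prop)
          ((Lp.aestronglyMeasurable _).norm.pow 2))).restrict
      · filter_upwards [ae_restrict_mem hTm] with ξ hξ
        have := hξ.1
        rw [Real.norm_of_nonneg (by positivity)]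
        simp only [he, Pi.add_apply]
        gcongr
    -- The integral inequality holds on every measurable subset of `T`, hence almost everywhere on
    -- `T`.
    have h := ae_le_of_forall_setIntegral_le (hint (ut t) (u t))
      ((hint u₁ u₀).const_mul (4 * Real.exp (-(ε / 2 * (r / (1 + r)) * I)))) ?_
    · rw [EventuallyLE, ae_restrict_iff' hTm] at h
      filter_upwards [h] with ξ h1 _ h2 h3 using h1 ⟨h2, h3⟩
    · intro S hS _
      rw [Measure.restrict_restrict hS, integral_const_mul]
      exact hu.setIntegral_energy_le hg hK hε0 (by rw [hε, one_div, inv_mul_cancel₀ hden.ne'])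
        (hS.inter hTm) (by exact_mod_cast hr) (fun ξ hξ => hξ.2.1) (fun ξ hξ => hξ.2.2) ht
  filter_upwards [ae_all_iff.2 fun r => ae_all_iff.2 (hae r)] with ξ hξ
  obtain ⟨R, hR⟩ := exists_nat_ge ‖ξ‖
  have hy : 0 ≤ (2 * Real.pi * ‖ξ‖) ^ 2 := sq_nonneg _
  obtain ⟨r, hr0, hr1, hr2⟩ := exists_rat_half_le hy
  refine (hξ r R hr0 hR hr2).trans ?_
  have h1 := half_div_one_add_le hy hr1
  have h2 : 0 ≤ e u₁ u₀ ξ := by positivity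
  refine mul_le_mul_of_nonneg_right ?_ h2
  refine mul_le_mul_of_nonneg_left (Real.exp_le_exp.2 (neg_le_neg ?_)) (by norm_num)
  refine mul_le_mul_of_nonneg_right ?_ hI0
  have := mul_le_mul_of_nonneg_left h1 hε0.le
  linarith

end Pointwise

/-! ### Symbol bounds and the Sobolev estimates -/

section SymbolEstimates

/-- The weight `ρ ^ a` times the exponential decay factor is controlled by the decay weight. -/
lemma exists_rpow_mul_exp_le {a c : ℝ} (ha : 0 ≤ a) (hc : 0 < c) :
    ∃ C : ℝ, 0 < C ∧ ∀ ρ I : ℝ, 0 ≤ ρ → 0 ≤ I →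
      ρ ^ a * Real.exp (-(c * (ρ ^ 2 / (1 + ρ ^ 2)) * I)) ≤
        C * ((1 + I) ^ (-a / 2) * (1 + ρ ^ 2) ^ (a / 2)) := by
  obtain ⟨M, hM0, hM⟩ : ∃ M : ℝ, 0 < M ∧ ∀ y : ℝ, 0 ≤ y →
      (1 + y) ^ (a / 2) * Real.exp (-(c * y)) ≤ M := by
    have h1 : Tendsto (fun x : ℝ => x ^ (a / 2) * Real.exp (-c * x)) atTop (𝓝 0) :=
      tendsto_rpow_mul_exp_neg_mul_atTop_nhds_zero _ _ hc
    have hcont : ContinuousOn (fun x : ℝ => x ^ (a / 2) * Real.exp (-c * x)) (Ici 1) := by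
      refine ContinuousOn.mul (continuousOn_id.rpow_const fun x _ => Or.inr (by positivity)) ?_
      fun_prop
    obtain ⟨N, hN⟩ := eventually_atTop.1 (h1.eventually (gt_mem_nhds one_pos))
    obtain ⟨B, hB⟩ := (isCompact_Icc (a := (1 : ℝ)) (b := N)).bddAbove_image
      (hcont.mono Icc_subset_Ici_self)
    -- `B` bounds the function on `[1, N]` and 1 bounds it beyond `N`; the factor `exp c` undoes the
    -- shift from `y` to `1 + y`.
    refine ⟨Real.exp c * max B 1, by positivity, fun y hy => ?_⟩
    have h2 : (1 + y) ^ (a / 2) * Real.exp (-c * (1 + y)) ≤ max B 1 := by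
      rcases le_total N (1 + y) with h | h
      · exact (hN _ h).le.trans (le_max_right _ _)
      · exact (hB (mem_image_of_mem _ ⟨by linarith, h⟩)).trans (le_max_left _ _)
    calc (1 + y) ^ (a / 2) * Real.exp (-(c * y))
        = Real.exp c * ((1 + y) ^ (a / 2) * Real.exp (-c * (1 + y))) := by
          rw [mul_left_comm, ← Real.exp_add]; ring_nf
      _ ≤ _ := mul_le_mul_of_nonneg_left h2 (Real.exp_pos _).le
  refine ⟨M, hM0, fun ρ I hρ hI => ?_⟩
  set x := ρ ^ 2 / (1 + ρ ^ 2) with hx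
  have hx0 : 0 ≤ x := by positivity
  have hx1 : x ≤ 1 := (div_le_one (by positivity)).2 (by linarith)
  have hρx : ρ ^ a = x ^ (a / 2) * (1 + ρ ^ 2) ^ (a / 2) := by
    rw [← Real.mul_rpow hx0 (by positivity), hx, div_mul_cancel₀ _ (by positivity),
      ← Real.rpow_natCast, ← Real.rpow_mul hρ]
    congr 1
    push_cast; ring
  have h1I : (0 : ℝ) < 1 + I := by linarith
  have hkey : x ^ (a / 2) * Real.exp (-(c * x * I)) ≤ M * (1 + I) ^ (-a / 2) := by
    rw [neg_div, Real.rpow_neg h1I.le, ← div_eq_mul_inv, le_div_iff₀ (by positivity)]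
    calc x ^ (a / 2) * Real.exp (-(c * x * I)) * (1 + I) ^ (a / 2)
        = (x * (1 + I)) ^ (a / 2) * Real.exp (-(c * (x * I))) := by
          rw [Real.mul_rpow hx0 h1I.le, mul_assoc c x I]; ring
      -- Since `x ≤ 1`, `x (1 + I) ≤ 1 + x I`.
      _ ≤ (1 + x * I) ^ (a / 2) * Real.exp (-(c * (x * I))) := by
          gcongr
          linarith
      _ ≤ M := hM _ (by positivity)
  calc ρ ^ a * Real.exp (-(c * x * I))
      = (x ^ (a / 2) * Real.exp (-(c * x * I))) * (1 + ρ ^ 2) ^ (a / 2) := by rw [hρx]; ring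
    _ ≤ (M * (1 + I) ^ (-a / 2)) * (1 + ρ ^ 2) ^ (a / 2) := by gcongr
    _ = _ := by ring

variable {n : ℕ}

lemma norm_multiplierOp {m : EuclideanSpace ℝ (Fin n) → ℝ} {f : L2 n}
    (hf : InMultiplierDomain m f) : ‖multiplierOp m f hf‖ = ‖(MemLp.toLp _ hf : L2 n)‖ :=
  (Lp.fourierTransformₗᵢ (EuclideanSpace ℝ (Fin n)) ℂ).symm.norm_map _

/-- By Plancherel, pointwise domination on the Fourier side controls the norm, and it also yields
membership in the domain of `m(D)`. -/
lemma exists_norm_multiplierOp_le {m m₀ m₁ : EuclideanSpace ℝ (Fin n) → ℝ} (hm : Measurable m)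
    {f f₀ f₁ : L2 n} (h₀ : InMultiplierDomain m₀ f₀) (h₁ : InMultiplierDomain m₁ f₁)
    {α β : ℝ} (hα : 0 ≤ α) (hβ : 0 ≤ β)
    (h : ∀ᵐ ξ, ‖(m ξ : ℂ) * (𝓕 f : L2 n) ξ‖ ≤
      α * ‖(m₀ ξ : ℂ) * (𝓕 f₀ : L2 n) ξ‖ + β * ‖(m₁ ξ : ℂ) * (𝓕 f₁ : L2 n) ξ‖) :
    ∃ hf : InMultiplierDomain m f, ‖multiplierOp m f hf‖ ≤
      α * ‖multiplierOp m₀ f₀ h₀‖ + β * ‖multiplierOp m₁ f₁ h₁‖ := by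
  have hd : MemLp (fun ξ => α * ‖(m₀ ξ : ℂ) * (𝓕 f₀ : L2 n) ξ‖ +
      β * ‖(m₁ ξ : ℂ) * (𝓕 f₁ : L2 n) ξ‖) 2 volume :=
    (h₀.norm.const_mul α).add (h₁.norm.const_mul β)
  have hf : InMultiplierDomain m f := by
    refine hd.mono' ?_ h
    exact (Complex.measurable_ofReal.comp hm).aestronglyMeasurable.mul (Lp.aestronglyMeasurable _)
  refine ⟨hf, ?_⟩
  rw [norm_multiplierOp, norm_multiplierOp, norm_multiplierOp]
  have hle : ‖(MemLp.toLp _ hf : L2 n)‖ ≤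
      ‖α • MemLp.toLp _ h₀.norm + β • MemLp.toLp _ h₁.norm‖ := by
    refine Lp.norm_le_norm_of_ae_le ?_
    filter_upwards [h, hf.coeFn_toLp, h₀.norm.coeFn_toLp, h₁.norm.coeFn_toLp,
      Lp.coeFn_add (α • MemLp.toLp _ h₀.norm) (β • MemLp.toLp _ h₁.norm),
      Lp.coeFn_smul α (MemLp.toLp _ h₀.norm), Lp.coeFn_smul β (MemLp.toLp _ h₁.norm)]
      with ξ a b c d e1 e2 e3
    rw [b, e1, Pi.add_apply, e2, e3, Pi.smul_apply, Pi.smul_apply, c, d]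
    exact a.trans (le_abs_self _)
  have hn : ∀ {F : EuclideanSpace ℝ (Fin n) → ℂ} (hF : MemLp F 2 volume),
      ‖MemLp.toLp _ hF.norm‖ = ‖MemLp.toLp _ hF‖ := by
    intro F hF
    rw [Lp.norm_toLp, Lp.norm_toLp, eLpNorm_norm]
  refine hle.trans ((norm_add_le _ _).trans ?_)
  rw [norm_smul, norm_smul, Real.norm_of_nonneg hα, Real.norm_of_nonneg hβ, hn h₀, hn h₁]

lemma measurable_rieszSymbol (s : ℝ) : Measurable (rieszSymbol n s) := by
  unfold rieszSymbol
  exact Measurable.pow_const (by fun_prop) s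

/-- The common estimate behind both decay rates. -/
lemma IsDecreasingCoefficient.exists_rieszD_le {g : ℝ → ℝ} (hg : IsDecreasingCoefficient g)
    {a : ℝ} (ha : 0 ≤ a) :
    ∃ C : ℝ, 0 < C ∧
      ∀ (u₀ u₁ : L2 n) (h₀ : InSobolevSpace (a + 1) u₀) (h₁ : InSobolevSpace a u₁)
        (u ut : ℝ → L2 n), IsSobolevSolution g u₀ u₁ u ut → ∀ t : ℝ, 0 ≤ t →
        (∃ h : InRieszDomain (a + 1) (u t), ‖rieszD (a + 1) (u t) h‖ ≤
          C * (decayWeight g t ^ (-(a + 1) / 2) * sobolevNorm (a + 1) u₀ h₀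
            + decayWeight g t ^ (-a / 2) * sobolevNorm a u₁ h₁)) ∧
        (∃ h : InRieszDomain a (ut t), ‖rieszD a (ut t) h‖ ≤
          C * (decayWeight g t ^ (-(a + 1) / 2) * sobolevNorm (a + 1) u₀ h₀
            + decayWeight g t ^ (-a / 2) * sobolevNorm a u₁ h₁)) := by
  obtain ⟨c, hc, hen⟩ := hg.exists_ae_energy_le (n := n)
  obtain ⟨C₀, hC₀, hw₀⟩ := exists_rpow_mul_exp_le (a := a + 1) (by linarith) (half_pos hc)
  obtain ⟨C₁, hC₁, hw₁⟩ := exists_rpow_mul_exp_le ha (half_pos hc)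
  refine ⟨2 * max C₀ C₁, by positivity, fun u₀ u₁ h₀ h₁ u ut hu t ht => ?_⟩
  have hI := hg.integral_nonneg ht
  have hG : decayWeight g t = 1 + ∫ τ in (0 : ℝ)..t, g τ := rfl
  set I := ∫ τ in (0 : ℝ)..t, g τ with hIdef
  have hG0 : 0 ≤ decayWeight g t := by rw [hG]; linarith
  set C := max C₀ C₁ with hC
  -- The free `y` stands for either root of an energy term: `ρ|û|` gives the bound for `u`, `|û_t|`
  -- the one for `u_t`.
  have hpt : ∀ᵐ ξ : EuclideanSpace ℝ (Fin n), ∀ y : ℝ, 0 ≤ y →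
      y ^ 2 ≤ ‖(𝓕 (ut t) : L2 n) ξ‖ ^ 2 +
        (2 * Real.pi * ‖ξ‖) ^ 2 * ‖(𝓕 (u t) : L2 n) ξ‖ ^ 2 →
      rieszSymbol n a ξ * y ≤
        2 * C * decayWeight g t ^ (-(a + 1) / 2) *
            ‖(besselSymbol n (a + 1) ξ : ℂ) * (𝓕 u₀ : L2 n) ξ‖ +
        2 * C * decayWeight g t ^ (-a / 2) *
            ‖(besselSymbol n a ξ : ℂ) * (𝓕 u₁ : L2 n) ξ‖ := by
    filter_upwards [hen u₀ u₁ u ut hu t ht] with ξ hξ y hy hyE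
    set ρ := 2 * Real.pi * ‖ξ‖ with hρ
    have hρ0 : 0 ≤ ρ := by positivity
    set x := ρ ^ 2 / (1 + ρ ^ 2) with hx
    set v₀ := ‖(𝓕 u₀ : L2 n) ξ‖ with hv₀
    set v₁ := ‖(𝓕 u₁ : L2 n) ξ‖ with hv₁
    have hb : ∀ s, 0 ≤ besselSymbol n s ξ := fun s => by unfold besselSymbol; positivity
    -- The energy is quadratic, so its square root decays at half the rate; hence `c / 2` in the
    -- symbol bounds.
    have hexp : Real.exp (-(c * x * I)) = Real.exp (-(c / 2 * x * I)) ^ 2 := by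
      rw [← Real.exp_nat_mul]; congr 1; push_cast; ring
    have hy1 : y ≤ 2 * Real.exp (-(c / 2 * x * I)) * (v₁ + ρ * v₀) := by
      refine le_of_sq_le_sq ?_ (by positivity)
      refine (hyE.trans hξ).trans ?_
      rw [hexp]
      have : v₁ ^ 2 + ρ ^ 2 * v₀ ^ 2 ≤ (v₁ + ρ * v₀) ^ 2 := by
        have : 0 ≤ v₁ * (ρ * v₀) := by positivity
        nlinarith
      calc 4 * Real.exp (-(c / 2 * x * I)) ^ 2 * (v₁ ^ 2 + ρ ^ 2 * v₀ ^ 2)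
          ≤ 4 * Real.exp (-(c / 2 * x * I)) ^ 2 * (v₁ + ρ * v₀) ^ 2 := by gcongr
        _ = _ := by ring
    have hz₀ := hw₀ ρ I hρ0 hI
    have hz₁ := hw₁ ρ I hρ0 hI
    rw [Real.rpow_add_one' hρ0 (by linarith)] at hz₀
    rw [norm_mul, norm_mul, Complex.norm_real, Complex.norm_real, Real.norm_of_nonneg (hb _),
      Real.norm_of_nonneg (hb _)]
    have e₀ : C₀ * ((1 + I) ^ (-(a + 1) / 2) * (1 + ρ ^ 2) ^ ((a + 1) / 2)) ≤
        C * (decayWeight g t ^ (-(a + 1) / 2) * besselSymbol n (a + 1) ξ) :=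
      mul_le_mul_of_nonneg_right (le_max_left _ _) (mul_nonneg (by positivity) (hb (a + 1)))
    have e₁ : C₁ * ((1 + I) ^ (-a / 2) * (1 + ρ ^ 2) ^ (a / 2)) ≤
        C * (decayWeight g t ^ (-a / 2) * besselSymbol n a ξ) :=
      mul_le_mul_of_nonneg_right (le_max_right _ _) (mul_nonneg (by positivity) (hb a))
    have hr : rieszSymbol n a ξ = ρ ^ a := rfl
    calc rieszSymbol n a ξ * y
        ≤ ρ ^ a * (2 * Real.exp (-(c / 2 * x * I)) * (v₁ + ρ * v₀)) := by
          rw [hr]; gcongr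
      _ = 2 * (ρ ^ a * ρ * Real.exp (-(c / 2 * x * I))) * v₀ +
          2 * (ρ ^ a * Real.exp (-(c / 2 * x * I))) * v₁ := by ring
      _ ≤ 2 * (C * (decayWeight g t ^ (-(a + 1) / 2) * besselSymbol n (a + 1) ξ)) * v₀ +
          2 * (C * (decayWeight g t ^ (-a / 2) * besselSymbol n a ξ)) * v₁ := by
          have b₀ := mul_le_mul_of_nonneg_right (hz₀.trans e₀) (norm_nonneg ((𝓕 u₀ : L2 n) ξ))
          have b₁ := mul_le_mul_of_nonneg_right (hz₁.trans e₁) (norm_nonneg ((𝓕 u₁ : L2 n) ξ))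
          simp only [mul_assoc] at b₀ b₁ ⊢
          linarith
      _ = _ := by ring
  have hrs : ∀ s ξ, 0 ≤ rieszSymbol n s ξ := fun s ξ => by unfold rieszSymbol; positivity
  have hα : 0 ≤ 2 * C * decayWeight g t ^ (-(a + 1) / 2) := by positivity
  have hβ : 0 ≤ 2 * C * decayWeight g t ^ (-a / 2) := by positivity
  constructor
  · refine (exists_norm_multiplierOp_le (f := u t) (measurable_rieszSymbol (a + 1))
      h₀ h₁ hα hβ ?_).imp fun h hle => hle.trans_eq ?_
    · filter_upwards [hpt] with ξ hξ
      rw [norm_mul, Complex.norm_real, Real.norm_of_nonneg (hrs _ _)]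
      refine le_of_eq_of_le ?_ (hξ (2 * Real.pi * ‖ξ‖ * ‖(𝓕 (u t) : L2 n) ξ‖) (by positivity) ?_)
      · unfold rieszSymbol
        rw [Real.rpow_add_one' (by positivity) (by linarith)]
        ring
      · rw [mul_pow]
        exact le_add_of_nonneg_left (sq_nonneg _)
    · simp only [sobolevNorm]; ring
  · refine (exists_norm_multiplierOp_le (f := ut t) (measurable_rieszSymbol a)
      h₀ h₁ hα hβ ?_).imp fun h hle => hle.trans_eq ?_
    · filter_upwards [hpt] with ξ hξ
      rw [norm_mul, Complex.norm_real, Real.norm_of_nonneg (hrs _ _)]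
      exact hξ _ (norm_nonneg _) (le_add_of_nonneg_right (by positivity))
    · simp only [sobolevNorm]; ring

end SymbolEstimates
end

theorem mainTheorem4 (n : ℕ) (g : ℝ → ℝ) (hg : IsDecreasingCoefficient g) :
    (∀ s : ℝ, 1 ≤ s → ∃ C : ℝ, 0 < C ∧
      ∀ (u₀ u₁ : L2 n) (h₀ : InSobolevSpace s u₀) (h₁ : InSobolevSpace (s - 1) u₁)
        (u ut : ℝ → L2 n), IsSobolevSolution g u₀ u₁ u ut →
        ∀ t : ℝ, 0 ≤ t → ∃ h : InRieszDomain s (u t),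
          ‖rieszD s (u t) h‖ ≤
            C * (decayWeight g t ^ (-s / 2) * sobolevNorm s u₀ h₀
              + decayWeight g t ^ (-(s - 1) / 2) * sobolevNorm (s - 1) u₁ h₁)) ∧
    (∀ s : ℝ, 0 ≤ s → ∃ C : ℝ, 0 < C ∧
      ∀ (u₀ u₁ : L2 n) (h₀ : InSobolevSpace (s + 1) u₀) (h₁ : InSobolevSpace s u₁)
        (u ut : ℝ → L2 n), IsSobolevSolution g u₀ u₁ u ut →
        ∀ t : ℝ, 0 ≤ t → ∃ h : InRieszDomain s (ut t),
          ‖rieszD s (ut t) h‖ ≤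
            C * (decayWeight g t ^ (-(s + 1) / 2) * sobolevNorm (s + 1) u₀ h₀
              + decayWeight g t ^ (-s / 2) * sobolevNorm s u₁ h₁)) ∧
    (∀ r s : ℝ, r < s →
      (fun t : ℝ => decayWeight g t ^ (-s / 2)) =o[atTop]
        (fun t : ℝ => decayWeight g t ^ (-r / 2))) := by
  refine ⟨fun s hs => ?_, fun s hs => ?_, fun r s h => hg.decayWeight_rpow_isLittleO h⟩
  · obtain ⟨a, rfl⟩ : ∃ a, s = a + 1 := ⟨s - 1, by ring⟩
    rw [add_sub_cancel_right]
    obtain ⟨C, hC, h⟩ := hg.exists_rieszD_le (n := n) (a := a) (by linarith)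
    exact ⟨C, hC, fun u₀ u₁ h₀ h₁ u ut hu t ht => (h u₀ u₁ h₀ h₁ u ut hu t ht).1⟩
  · obtain ⟨C, hC, h⟩ := hg.exists_rieszD_le (n := n) hs
    exact ⟨C, hC, fun u₀ u₁ h₀ h₁ u ut hu t ht => (h u₀ u₁ h₀ h₁ u ut hu t ht).2⟩
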